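/- Setting. A continuous even convex $\varphi:\mathbb R\to\mathbb R$ is an Orlicz N-function if it is increasing on $(0,\infty)$, $\varphi(0)=0$, $\varphi(x)/x\to0$ as $x\to0$ and $\varphi(x)/x\to\infty$ as $x\to\infty$; it then has a density $f$, i.e. $\varphi(u)=\int_0^{|u|}f(v)\,dv$ with $f$ non-decreasing and right-continuous on $[0,\infty)$, $f(0)=0$. Write $\varphi^*(x)=\sup_{y\in\mathbb R}(xy-\varphi(y))$ and let $\varphi^{(-1)}$ be the inverse of $\varphi$ on $[0,\infty)$. $\varphi$ satisfies Condition Q if $\lim_{x\to0}\varphi(x)/x^2$ exists in $(0,\infty]$. A zero mean random variable $\xi$ belongs to $Sub_\varphi(\Omega)$ if for some $a\ge0$ one has $\mathbf E e^{\lambda\xi}\le e^{\varphi(a\lambda)}$ for all $\lambda\in\mathbb R$; its norm is $\tau_\varphi(\xi)=\sup_{\lambda\ne0}\varphi^{(-1)}(\ln\mathbf E e^{\lambda\xi})/|\lambda|$. A process $\mathbf X$ is $SSub_\varphi(\Omega)$ with determinative constant $C_{\mathbf X}>0$ if all $\mathbf X(t)$ are in $Sub_\varphi(\Omega)$ and $\tau_\varphi(\xi)\le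 C_{\mathbf X}(\mathbf E\xi^2)^{1/2}$ for every finite real linear combination $\xi$ of the variables $\mathbf X(t)$. Theorem. Let $\varphi$ be an Orlicz N-function satisfying Condition Q, with density $f$. Let $\mathbf X(t)$, $t\in\mathbb R$, be a real measurable, (wide-sense) stationary $SSub_\varphi(\Omega)$ process with determinative constant $C_{\mathbf X}$ and covariance function $\mathbf B(\tau)=\mathbf E\,\mathbf X(t+\tau)\mathbf X(t)=\int_{[-\Lambda,\Lambda)}e^{i\tau\lambda}\,dF(\lambda)$, where $F$ is a finite measure. Let $\omega>\Lambda>0$, $T>0$, $p\ge1$, $z\in(0,1)$, let $n\ge\frac{\omega T}{\pi\sqrt z}$ be an integer, and put $$\mathbf X_n(t)=\sum_{k=-n}^{n}\frac{\sin(\omega(t-\frac{k\pi}{\omega}))}{\omega(t-\frac{k\pi}{\omega})}\,\mathbf X\!\left(\frac{k\pi}{\omega}\right)$$ (the coefficient being $1$ when $t=k\pi/\omega$), $$C_n(t)=\mathbf B(0)\left(\frac{4\omega t}{\pi^2(1-z)}+\frac{4(z+1+\frac1n)}{\pi(1-z)^2(1-\frac{\Lambda}{\omega})}\right)^2,\qquad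 S_{n,p}=\left(\frac{C_{\mathbf X}}{n}\right)^p\int_0^TC_n(t)^{p/2}\,dt.$$ Let $\varepsilon>0$ and $0<\delta<1$. If $$\varepsilon>S_{n,p}\Bigl(f\bigl(p\,(S_{n,p}/\varepsilon)^{1/p}\bigr)\Bigr)^p\quad\text{and}\quad\exp\bigl\{-\varphi^*\bigl((\varepsilon/S_{n,p})^{1/p}\bigr)\bigr\}\le\delta/2,$$ then $\mathbf X_n$ approximates $\mathbf X$ in $L_p([0,T])$ with accuracy $\varepsilon$ and reliability $1-\delta$; that is, $\int_0^T|\mathbf X(t)-\mathbf X_n(t)|^p\,dt$ exists with probability $1$ and $$\mathbf P\Bigl\{\int_0^T|\mathbf X(t)-\mathbf X_n(t)|^p\,dt>\varepsilon\Bigr\}\le\delta.$$ -/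

import Mathlib

open MeasureTheory ProbabilityTheory Filter Topology Set

noncomputable section

/-- An Orlicz N-function: a continuous even convex function, increasing on `x > 0`, with `φ 0 = 0`,
`φ x / x → 0` as `x → 0` and `φ x / x → ∞` as `x → ∞`. -/
structure IsOrliczNFunction (φ : ℝ → ℝ) : Prop where
  continuous : Continuous φ
  even : ∀ x, φ (-x) = φ x
  convex : ConvexOn ℝ univ φ
  strictMono : StrictMonoOn φ (Ioi 0)
  map_zero : φ 0 = 0
  tendsto_zero : Tendsto (fun x => φ x / x) (𝓝[≠] 0) (𝓝 0)
  tendsto_atTop : Tendsto (fun x => φ x / x) atTop atTop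

/-- Condition Q: `φ x / x ^ 2` has a limit in `(0, ∞]` as `x → 0`. -/
def ConditionQ (φ : ℝ → ℝ) : Prop :=
  (∃ C : ℝ, 0 < C ∧ Tendsto (fun x => φ x / x ^ 2) (𝓝[≠] 0) (𝓝 C)) ∨
    Tendsto (fun x => φ x / x ^ 2) (𝓝[≠] 0) atTop

/-- The Young-Fenchel transform `φ* x = sup_y (x y - φ y)`; the supremum is finite for an
Orlicz N-function. -/
def youngFenchel (φ : ℝ → ℝ) (x : ℝ) : ℝ := ⨆ y : ℝ, (x * y - φ y)

/-- The density `f` of an Orlicz N-function `φ`, i.e. the non-decreasing right-continuous `f` on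
`[0, ∞)` with `φ u = ∫_0^{|u|} f v dv`, built as the right derivative of `φ`. That it is the
function with these properties is `isOrliczDensity_orliczDensity` and
`IsOrliczDensity.eq_orliczDensity` below. -/
def orliczDensity (φ : ℝ → ℝ) (x : ℝ) : ℝ := derivWithin φ (Ioi x) x

/-- `f` is a density of `φ`: `φ u = ∫_0^{|u|} f v dv` with `f` non-decreasing and right-continuous
on `[0, ∞)`, `f 0 = 0` and `f x → ∞` as `x → ∞`. -/
structure IsOrliczDensity (φ f : ℝ → ℝ) : Prop where
  integral_eq : ∀ u, φ u = ∫ v in (0 : ℝ)..|u|, f v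
  mono : MonotoneOn f (Ici 0)
  rightCont : ∀ x, 0 ≤ x → ContinuousWithinAt f (Ici x) x
  map_zero : f 0 = 0
  tendsto_atTop : Tendsto f atTop atTop

theorem monotone_orliczDensity {φ : ℝ → ℝ} (h : IsOrliczNFunction φ) :
    Monotone (orliczDensity φ) := by
  have := h.convex.monotoneOn_rightDeriv
  rw [interior_univ, monotoneOn_univ] at this
  exact this

theorem hasDerivWithinAt_orliczDensity {φ : ℝ → ℝ} (h : IsOrliczNFunction φ) (x : ℝ) :
    HasDerivWithinAt φ (orliczDensity φ x) (Ioi x) x :=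
  h.convex.hasDerivWithinAt_rightDeriv_of_mem_interior (by simp)

theorem isOrliczDensity_orliczDensity {φ : ℝ → ℝ} (h : IsOrliczNFunction φ) :
    IsOrliczDensity φ (orliczDensity φ) where
  integral_eq u := by
    have hu : φ u = φ |u| := by
      rcases abs_choice u with h' | h' <;> rw [h']
      exact (h.even u).symm
    rw [intervalIntegral.integral_eq_sub_of_hasDeriv_right_of_le (abs_nonneg u)
      h.continuous.continuousOn (fun x _ => hasDerivWithinAt_orliczDensity h x)
      (monotone_orliczDensity h).intervalIntegrable, h.map_zero, sub_zero, hu]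
  mono := (monotone_orliczDensity h).monotoneOn _
  rightCont x _ := by
    have hd := hasDerivWithinAt_orliczDensity h x
    rw [hasDerivWithinAt_iff_tendsto_slope' self_notMem_Ioi] at hd
    rw [ContinuousWithinAt, tendsto_order]
    refine ⟨fun a ha => ?_, fun a ha => ?_⟩
    · filter_upwards [self_mem_nhdsWithin] with y hy
      exact ha.trans_le (monotone_orliczDensity h hy)
    · obtain ⟨y, hy1, hy2⟩ := ((hd.eventually_lt_const ha).and self_mem_nhdsWithin).exists
      have hy2 : x < y := hy2
      have hc : ContinuousAt (fun x' => (φ y - φ x') / (y - x')) x :=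
        (continuousAt_const.sub h.continuous.continuousAt).div
          (continuousAt_const.sub continuousAt_id) (sub_pos.2 hy2).ne'
      have h1 : ∀ᶠ x' in 𝓝 x, (φ y - φ x') / (y - x') < a := by
        refine hc.eventually_lt_const ?_
        rwa [slope_def_field] at hy1
      filter_upwards [nhdsWithin_le_nhds h1, nhdsWithin_le_nhds (Iio_mem_nhds hy2)] with x' hx1 hx2
      refine lt_of_le_of_lt ?_ hx1
      have := h.convex.rightDeriv_le_slope_of_mem_interior (x := x') (y := y) (by simp)
        (mem_univ _) hx2
      rwa [slope_def_field] at this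
  map_zero := by
    have hd := hasDerivWithinAt_orliczDensity h 0
    rw [hasDerivWithinAt_iff_tendsto_slope' self_notMem_Ioi] at hd
    refine tendsto_nhds_unique hd ?_
    have h0 := h.tendsto_zero.mono_left (nhdsWithin_mono 0 (s := Ioi 0) (fun x hx => ne_of_gt hx))
    refine h0.congr fun x => ?_
    rw [slope_def_field, h.map_zero, sub_zero, sub_zero]
  tendsto_atTop := by
    refine tendsto_atTop_mono' _ ?_ h.tendsto_atTop
    filter_upwards [eventually_gt_atTop 0] with x hx
    have h1 := h.convex.slope_le_leftDeriv_of_mem_interior (x := 0) (y := x) (mem_univ _)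
      (by simp) hx
    have h2 := h.convex.leftDeriv_le_rightDeriv_of_mem_interior (x := x) (by simp)
    rw [slope_def_field, h.map_zero, sub_zero, sub_zero] at h1
    exact h1.trans h2

theorem IsOrliczDensity.eq_orliczDensity {φ f : ℝ → ℝ} (h : IsOrliczDensity φ f) {x : ℝ}
    (hx : 0 ≤ x) : f x = orliczDensity φ x := by
  have hint : IntervalIntegrable f volume 0 x :=
    MonotoneOn.intervalIntegrable (h.mono.mono (by rw [uIcc_of_le hx]; exact Icc_subset_Ici_self))
  have hmeas : StronglyMeasurableAtFilter f (𝓝[>] x) volume := by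
    refine ⟨Ioi x, self_mem_nhdsWithin, ?_⟩
    exact (aemeasurable_restrict_of_monotoneOn measurableSet_Ioi
      (h.mono.mono fun y hy => hx.trans (le_of_lt hy))).aestronglyMeasurable
  have h1 := intervalIntegral.integral_hasDerivWithinAt_right hint (s := Ici x) (t := Ioi x) hmeas
    ((h.rightCont x hx).mono Ioi_subset_Ici_self)
  have h2 : HasDerivWithinAt φ (f x) (Ioi x) x := by
    refine (h1.mono Ioi_subset_Ici_self).congr (fun y hy => ?_) ?_
    · rw [h.integral_eq y, abs_of_nonneg (hx.trans (le_of_lt hy))]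
    · rw [h.integral_eq x, abs_of_nonneg hx]
  exact (h2.derivWithin (uniqueDiffWithinAt_Ioi x)).symm

/-- The inverse function `φ^(-1) : [0, ∞) → [0, ∞)` of an Orlicz N-function. -/
def orliczInv (φ : ℝ → ℝ) (y : ℝ) : ℝ := Function.invFunOn φ (Ici 0) y

variable {Ω : Type*} [MeasurableSpace Ω]

/-- `ξ` belongs to `Sub_φ(Ω)`: it has zero mean and `E exp(l ξ) ≤ exp(φ(a l))` for all real `l`
and some `a ≥ 0` (the exponential moments being finite). -/
def MemSub (φ : ℝ → ℝ) (P : Measure Ω) (ξ : Ω → ℝ) : Prop :=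
  Integrable ξ P ∧ ∫ w, ξ w ∂P = 0 ∧
    ∃ a : ℝ, 0 ≤ a ∧ ∀ l : ℝ, Integrable (fun w => Real.exp (l * ξ w)) P ∧
      ∫ w, Real.exp (l * ξ w) ∂P ≤ Real.exp (φ (a * l))

/-- The norm `τ_φ(ξ) = sup_{l ≠ 0} φ^(-1)(ln E exp(l ξ)) / |l|` of `Sub_φ(Ω)`. -/
def tauNorm (φ : ℝ → ℝ) (P : Measure Ω) (ξ : Ω → ℝ) : ℝ :=
  ⨆ l : {l : ℝ // l ≠ 0},
    orliczInv φ (Real.log (∫ w, Real.exp ((l : ℝ) * ξ w) ∂P)) / |(l : ℝ)|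

/-- The family `Ξ` is strictly `Sub_φ(Ω)` (an `SSub_φ(Ω)` family) with determinative constant
`C > 0`. -/
def IsSSubWith {ι : Type*} (φ : ℝ → ℝ) (P : Measure Ω) (Ξ : ι → Ω → ℝ) (C : ℝ) : Prop :=
  (∀ i, MemSub φ P (Ξ i)) ∧ 0 < C ∧
    ∀ (m : ℕ) (i : Fin m → ι) (c : Fin m → ℝ),
      tauNorm φ P (fun w => ∑ j, c j * Ξ (i j) w) ≤
        C * √(∫ w, (∑ j, c j * Ξ (i j) w) ^ 2 ∂P)

/-- The covariance function `B τ = E X(τ) X(0)` of a centered stationary process. -/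
def covFun (P : Measure Ω) (X : ℝ → Ω → ℝ) (τ : ℝ) : ℝ := ∫ w, X τ w * X 0 w ∂P

/-- `X` is a centered (wide-sense) stationary process. -/
structure IsCenteredStationary (P : Measure Ω) (X : ℝ → Ω → ℝ) : Prop where
  memLp : ∀ t, MemLp (X t) 2 P
  mean_zero : ∀ t, ∫ w, X t w ∂P = 0
  cov_eq : ∀ t τ, ∫ w, X (t + τ) w * X t w ∂P = covFun P X τ

/-- The spectrum of `X` is bandlimited to `[-Λ, Λ)`: `B τ = ∫_{[-Λ, Λ)} e^{i τ l} dF(l)` for a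
finite spectral measure `F`. -/
def IsBandlimited (P : Measure Ω) (X : ℝ → Ω → ℝ) (Λ : ℝ) : Prop :=
  ∃ F : Measure ℝ, IsFiniteMeasure F ∧ ∀ τ : ℝ,
    (covFun P X τ : ℂ) = ∫ l in Ico (-Λ) Λ, Complex.exp (Complex.I * τ * l) ∂F

/-- The truncated sampling sum `X_n(t)`; `Real.sinc x = sin x / x`, with value `1` at `0`. -/
def truncSum (ω : ℝ) (X : ℝ → Ω → ℝ) (n : ℕ) (t : ℝ) (w : Ω) : ℝ :=
  ∑ k ∈ Finset.Icc (-(n : ℤ)) n,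
    Real.sinc (ω * (t - k * Real.pi / ω)) * X (k * Real.pi / ω) w

/-- The function `C_n(t)`, where `B0 = B(0)`. -/
def errC (B0 ω Λ z : ℝ) (n : ℕ) (t : ℝ) : ℝ :=
  B0 * (4 * ω * t / (Real.pi ^ 2 * (1 - z)) +
    4 * (z + 1 + 1 / n) / (Real.pi * (1 - z) ^ 2 * (1 - Λ / ω))) ^ 2

/-- The quantity `S_{n,p} = (C_X / n)^p ∫_0^T C_n(t)^{p/2} dt`. -/
def errS (CX B0 ω Λ z T p : ℝ) (n : ℕ) : ℝ :=
  (CX / n) ^ p * ∫ t in (0 : ℝ)..T, errC B0 ω Λ z n t ^ (p / 2)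

/-- `Y` approximates `X` in `L_p([0,T])` with accuracy `ε` and reliability `1 - δ`: the integral
`∫_0^T |X(t) - Y(t)|^p dt` exists with probability one and exceeds `ε` with probability at most
`δ`. -/
def ApproximatesLp (P : Measure Ω) (X Y : ℝ → Ω → ℝ) (p T ε δ : ℝ) : Prop :=
  (∀ᵐ w ∂P, IntervalIntegrable (fun t => |X t w - Y t w| ^ p) volume 0 T) ∧
    P.real {w | ε < ∫ t in (0 : ℝ)..T, |X t w - Y t w| ^ p} ≤ δ

end

/-! For fixed `t`, the error `Y(t) = X(t) - X_n(t)` is a finite linear combination of values of the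
process. The strict sub-`φ` property therefore reduces its exponential moments to its variance: `E
exp(l Y(t)) ≤ exp(φ(τ(t) l))` with `τ(t) = C_X √C_n(t) / n`, once the variance is at most
`C_n(t)/n²`.

The variance is a spectral integral (`IsCenteredStationary.integral_sum_sq_le`), so it suffices to
bound uniformly the truncation error of the sampling series of `α ↦ exp(i s α)`, where `s = ω t` and
`|α| ≤ Λ/ω < 1`. That series converges too slowly for absolute bounds. Multiplication by `1 +
exp(iπα)`, which vanishes at `α = ±1`, pairs neighbouring coefficients; the paired coefficients are
dominated by telescoping differences, and division by the factor costs only `1/(2(1-|α|))`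
(`norm_exp_sub_sum_sinc_le`).

For the passage to `L_p`, a pointwise convexity inequality bounds `∫|Y|^p` by an average of
exponentials, and Markov's inequality gives the tail `2 exp(φ(y) - a y)` for every `y ≥ p/a`, where
`S a^p = ε` and `S = ∫ τ^p` (`measure_integral_rpow_gt_le`). The condition on the density places the
optimal `y` in this range, so optimising yields `2 exp(-φ*(a)) ≤ δ`
(`le_two_mul_exp_neg_youngFenchel`). -/

section

/-! ### Orlicz N-functions: monotonicity, inverse, supporting lines. -/

namespace IsOrliczNFunction

variable {φ : ℝ → ℝ}

theorem nonneg (h : IsOrliczNFunction φ) (x : ℝ) : 0 ≤ φ x := by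
  have := h.convex.2 (mem_univ x) (mem_univ (-x)) (show (0 : ℝ) ≤ 1 / 2 by norm_num)
    (show (0 : ℝ) ≤ 1 / 2 by norm_num) (by norm_num)
  simp only [smul_eq_mul, h.even] at this
  rw [show 1 / 2 * x + 1 / 2 * -x = 0 by ring, h.map_zero] at this
  linarith

theorem strictMonoOn_Ici (h : IsOrliczNFunction φ) : StrictMonoOn φ (Ici 0) := by
  intro x hx y _ hxy
  rcases eq_or_lt_of_le (show (0 : ℝ) ≤ x from hx) with rfl | hx
  · rw [h.map_zero]
    exact (h.nonneg (y / 2)).trans_lt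
      (h.strictMono (half_pos hxy) (show (0 : ℝ) < y from hxy) (half_lt_self hxy))
  · exact h.strictMono hx (hx.trans hxy) hxy

theorem map_abs (h : IsOrliczNFunction φ) (x : ℝ) : φ |x| = φ x := by
  rcases abs_choice x with h' | h' <;> rw [h']
  exact h.even x

theorem map_le_map (h : IsOrliczNFunction φ) {x y : ℝ} (hxy : |x| ≤ |y|) : φ x ≤ φ y := by
  rw [← h.map_abs x, ← h.map_abs y]
  exact h.strictMonoOn_Ici.monotoneOn (abs_nonneg x) (abs_nonneg y) hxy

theorem surjOn (h : IsOrliczNFunction φ) : SurjOn φ (Ici 0) (Ici 0) := by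
  intro y hy
  obtain ⟨x, hx, hx'⟩ := ((h.tendsto_atTop.eventually_ge_atTop 1).and
    (eventually_ge_atTop (max y 1))).exists
  have hx0 : 0 < x := lt_of_lt_of_le one_pos ((le_max_right _ _).trans hx')
  have hyx : y ≤ φ x := by
    rw [le_div_iff₀ hx0, one_mul] at hx
    exact ((le_max_left _ _).trans hx').trans hx
  obtain ⟨u, hu, rfl⟩ := intermediate_value_Icc hx0.le h.continuous.continuousOn
    ⟨h.map_zero.trans_le hy, hyx⟩
  exact ⟨u, hu.1, rfl⟩

theorem orliczInv_nonneg (h : IsOrliczNFunction φ) {y : ℝ} (hy : 0 ≤ y) : 0 ≤ orliczInv φ y :=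
  Function.invFunOn_mem (h.surjOn hy)

theorem map_orliczInv (h : IsOrliczNFunction φ) {y : ℝ} (hy : 0 ≤ y) : φ (orliczInv φ y) = y :=
  Function.invFunOn_eq (h.surjOn hy)

theorem orliczInv_le_iff (h : IsOrliczNFunction φ) {x y : ℝ} (hx : 0 ≤ x) (hy : 0 ≤ y) :
    orliczInv φ y ≤ x ↔ y ≤ φ x := by
  rw [← h.strictMonoOn_Ici.le_iff_le (h.orliczInv_nonneg hy) hx, h.map_orliczInv hy]

/-- The right derivative at `x` dominates the left derivative, hence every chord slope to the left
of `x`. -/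
theorem add_orliczDensity_mul_le (h : IsOrliczNFunction φ) {x y : ℝ} (hyx : y < x) :
    φ x + orliczDensity φ x * (y - x) ≤ φ y := by
  have h1 := h.convex.slope_le_leftDeriv_of_mem_interior (x := y) (y := x) (mem_univ _)
    (by simp) hyx
  have h2 := h.convex.leftDeriv_le_rightDeriv_of_mem_interior (x := x) (by simp)
  rw [slope_def_field] at h1
  have h3 : (φ x - φ y) / (x - y) ≤ orliczDensity φ x := h1.trans h2
  rw [div_le_iff₀ (by linarith)] at h3
  linarith

end IsOrliczNFunction

/-! ### Sub-`φ` random variables and their exponential moments. -/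

variable {Ω : Type*} [MeasurableSpace Ω] {P : Measure Ω} {φ : ℝ → ℝ}

/-- Convexity of `exp` with equal weights `1/m` avoids any independence or Hölder argument. The
constant `A` is crude, but only membership is needed: the sharp constant comes later from the
determinative constant. -/
theorem MemSub.sum {κ : Type*} [Fintype κ] [Nonempty κ] (hφ : IsOrliczNFunction φ)
    {ξ : κ → Ω → ℝ} (hξ : ∀ i, MemSub φ P (ξ i)) (c : κ → ℝ) :
    MemSub φ P (fun w => ∑ i, c i * ξ i w) := by
  choose hint hmean a ha hexp using hξ
  refine ⟨integrable_finsetSum _ fun i _ => (hint i).const_mul _, ?_, ?_⟩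
  · rw [integral_finsetSum _ fun i _ => (hint i).const_mul _]
    simp [integral_const_mul, hmean]
  have hm : (0 : ℝ) < Fintype.card κ := by exact_mod_cast Fintype.card_pos
  set m : ℝ := ((Fintype.card κ : ℕ) : ℝ) with hm_def
  set A : ℝ := m * ∑ i, a i * |c i| with hA
  have hai : ∀ i, 0 ≤ a i * |c i| := fun i => mul_nonneg (ha i) (abs_nonneg _)
  have hsum1 : ∑ _i : κ, 1 / m = 1 := by
    simp [Finset.card_univ, ← hm_def, hm.ne']
  refine ⟨A, mul_nonneg hm.le (Finset.sum_nonneg fun i _ => hai i), fun l => ?_⟩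
  have hpt : ∀ w, Real.exp (l * ∑ i, c i * ξ i w) ≤
      ∑ i, 1 / m * Real.exp (m * l * c i * ξ i w) := fun w => by
    have := convexOn_exp.map_sum_le (t := Finset.univ) (w := fun _ : κ => 1 / m)
      (p := fun i => m * l * c i * ξ i w) (fun _ _ => by positivity) hsum1 (fun _ _ => mem_univ _)
    simp only [smul_eq_mul] at this
    refine (le_of_eq ?_).trans this
    rw [Finset.mul_sum]
    congr 1
    refine Finset.sum_congr rfl fun i _ => ?_
    field_simp
  have hint' : Integrable (fun w => ∑ i, 1 / m * Real.exp (m * l * c i * ξ i w)) P :=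
    integrable_finsetSum _ fun i _ => ((hexp i _).1).const_mul _
  have hint'' : Integrable (fun w => Real.exp (l * ∑ i, c i * ξ i w)) P := by
    refine hint'.mono' ?_ (Eventually.of_forall fun w => ?_)
    · exact Real.continuous_exp.comp_aestronglyMeasurable
        ((integrable_finsetSum Finset.univ fun i _ =>
          (hint i).const_mul (c i)).aestronglyMeasurable.const_mul l)
    · rw [Real.norm_of_nonneg (Real.exp_pos _).le]
      exact hpt w
  refine ⟨hint'', (integral_mono hint'' hint' hpt).trans ?_⟩
  rw [integral_finsetSum _ fun i _ => ((hexp i _).1).const_mul _]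
  calc ∑ i, ∫ w, 1 / m * Real.exp (m * l * c i * ξ i w) ∂P
      ≤ ∑ _i : κ, 1 / m * Real.exp (φ (A * l)) := by
        refine Finset.sum_le_sum fun i _ => ?_
        rw [integral_const_mul]
        refine mul_le_mul_of_nonneg_left ((hexp i _).2.trans (Real.exp_le_exp.2 ?_)) (by positivity)
        refine hφ.map_le_map ?_
        have h1 : a i * |c i| ≤ ∑ i, a i * |c i| :=
          Finset.single_le_sum (f := fun i => a i * |c i|) (fun i _ => hai i) (Finset.mem_univ i)
        rw [show a i * (m * l * c i) = m * (a i * c i) * l by ring, abs_mul, abs_mul, abs_mul,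
          abs_mul, abs_mul, abs_of_pos hm, abs_of_nonneg (ha i),
          abs_of_nonneg (Finset.sum_nonneg fun i _ => hai i)]
        gcongr
    _ = Real.exp (φ (A * l)) := by rw [← Finset.sum_mul, hsum1, one_mul]

variable [IsProbabilityMeasure P]

/-- Zero mean and `exp x ≥ 1 + x`. The sign matters because `orliczInv` is an inverse only on `[0,
∞)`. -/
theorem MemSub.log_nonneg {ξ : Ω → ℝ} (hξ : MemSub φ P ξ) (l : ℝ) :
    0 ≤ Real.log (∫ w, Real.exp (l * ξ w) ∂P) := by
  obtain ⟨hint, hmean, a, -, hexp⟩ := hξ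
  refine Real.log_nonneg ?_
  have h : ∫ w, (l * ξ w + 1) ∂P ≤ ∫ w, Real.exp (l * ξ w) ∂P :=
    integral_mono ((hint.const_mul l).add (integrable_const _)) (hexp l).1
      fun w => Real.add_one_le_exp _
  rwa [integral_add (hint.const_mul l) (integrable_const _), integral_const_mul, hmean,
    mul_zero, zero_add, integral_const, probReal_univ, one_smul] at h

theorem MemSub.integral_exp_le (hφ : IsOrliczNFunction φ) {ξ : Ω → ℝ} (hξ : MemSub φ P ξ)
    {τ : ℝ} (hτ : tauNorm φ P ξ ≤ τ) (l : ℝ) :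
    ∫ w, Real.exp (l * ξ w) ∂P ≤ Real.exp (φ (τ * l)) := by
  rcases eq_or_ne l 0 with rfl | hl
  · simp [hφ.map_zero]
  have hlog := hξ.log_nonneg
  obtain ⟨-, -, a, ha, hexp⟩ := hξ
  have hpos : ∀ l, 0 < ∫ w, Real.exp (l * ξ w) ∂P := fun l => integral_exp_pos (hexp l).1
  -- A real supremum of an unbounded set is `0` by default; membership in the space supplies the
  -- bound that makes `tauNorm` a true supremum.
  have hbdd : BddAbove (range fun l : {l : ℝ // l ≠ 0} =>
      orliczInv φ (Real.log (∫ w, Real.exp ((l : ℝ) * ξ w) ∂P)) / |(l : ℝ)|) := by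
    refine ⟨a, ?_⟩
    rintro _ ⟨⟨l, hl⟩, rfl⟩
    simp only
    rw [div_le_iff₀ (abs_pos.2 hl), hφ.orliczInv_le_iff (by positivity) (hlog l),
      Real.log_le_iff_le_exp (hpos l), ← abs_of_nonneg ha, ← abs_mul, hφ.map_abs]
    exact (hexp l).2
  have h1 : orliczInv φ (Real.log (∫ w, Real.exp (l * ξ w) ∂P)) / |l| ≤ τ :=
    (le_ciSup hbdd ⟨l, hl⟩).trans hτ
  have hτ0 : 0 ≤ τ := (div_nonneg (hφ.orliczInv_nonneg (hlog l)) (abs_nonneg l)).trans h1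
  rwa [div_le_iff₀ (abs_pos.2 hl), hφ.orliczInv_le_iff (by positivity) (hlog l),
    Real.log_le_iff_le_exp (hpos l), ← abs_of_nonneg hτ0, ← abs_mul, hφ.map_abs] at h1

end

/-! ### Truncation of the sampling series of a complex exponential. -/

theorem integral_exp_I_mul_eq_sinc (r : ℝ) :
    ∫ x in (-1 : ℝ)..1, Complex.exp (Complex.I * r * x) = 2 * Real.sinc r := by
  rcases eq_or_ne r 0 with rfl | hr
  · simp; norm_num
  have hrC : (r : ℂ) ≠ 0 := by exact_mod_cast hr
  rw [integral_exp_mul_complex (mul_ne_zero Complex.I_ne_zero hrC), Real.sinc_of_ne_zero hr]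
  push_cast
  rw [show Complex.I * (r : ℂ) * 1 = r * Complex.I by ring,
    show Complex.I * (r : ℂ) * -1 = (-r : ℂ) * Complex.I by ring,
    Complex.exp_mul_I, Complex.exp_mul_I, Complex.cos_neg, Complex.sin_neg]
  field_simp
  ring

/-- The `k`-th Fourier coefficient on `[-1, 1]` of `x ↦ (1 + exp (i π x)) exp (i s x)`. -/
noncomputable def sincPair (s : ℝ) (k : ℤ) : ℝ :=
  Real.sinc (s - k * Real.pi) + Real.sinc (s - (k - 1) * Real.pi)

theorem abs_sinc_sub_int_mul_pi_le {s : ℝ} {k : ℤ} (h : s - k * Real.pi ≠ 0) :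
    |Real.sinc (s - k * Real.pi)| ≤ 1 / |s - k * Real.pi| := by
  rw [Real.sinc_of_ne_zero h, abs_div]
  gcongr
  exact Real.abs_sin_le_one _

/-- The two arguments differ by `π`, so the sines are opposite and the pair becomes a difference of
reciprocals, of quadratic rather than linear decay. -/
theorem abs_sincPair_le {s : ℝ} {k : ℤ} (h : 0 < (s - k * Real.pi) * (s - (k - 1) * Real.pi)) :
    |sincPair s k| ≤ |1 / (s - k * Real.pi) - 1 / (s - (k - 1) * Real.pi)| := by
  have h1 := left_ne_zero_of_mul h.ne'
  have h2 := right_ne_zero_of_mul h.ne'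
  rw [sincPair, Real.sinc_of_ne_zero h1, Real.sinc_of_ne_zero h2,
    show s - (k - 1) * Real.pi = s - k * Real.pi + Real.pi by ring, Real.sin_add_pi,
    show ∀ a b c : ℝ, a / b + -a / c = a * (1 / b - 1 / c) by intros; ring, abs_mul]
  exact mul_le_of_le_one_left (abs_nonneg _) (Real.abs_sin_le_one _)

theorem abs_sincPair_succ_le {s : ℝ} {N : ℕ} (h : s < N * Real.pi) :
    |sincPair s (N + 1 : ℕ)| ≤ 1 / (N * Real.pi - s) - 1 / ((N + 1 : ℕ) * Real.pi - s) := by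
  have hp := Real.pi_pos
  have h1 : 0 < N * Real.pi - s := by linarith
  have h2 : 0 < (N + 1 : ℝ) * Real.pi - s := by linarith
  refine (abs_sincPair_le ?_).trans (le_of_eq ?_)
  · push_cast
    nlinarith
  push_cast
  rw [show s - (N + 1) * Real.pi = -((N + 1) * Real.pi - s) by ring,
    show s - (N + 1 - 1) * Real.pi = -(N * Real.pi - s) by ring, one_div_neg_eq_neg_one_div,
    one_div_neg_eq_neg_one_div, neg_sub_neg, abs_of_nonneg]
  exact sub_nonneg.2 (one_div_le_one_div_of_le h1 (by linarith))

theorem abs_sincPair_neg_succ_le {s : ℝ} (hs : 0 ≤ s) (N : ℕ) :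
    |sincPair s (-(N + 1 : ℕ))| ≤
      1 / (s + (N + 1 : ℕ) * Real.pi) - 1 / (s + (N + 1 + 1 : ℕ) * Real.pi) := by
  have hp := Real.pi_pos
  have hN : 0 ≤ N * Real.pi := by positivity
  have h1 : 0 < s + (N + 1) * Real.pi := by linarith
  have h2 : 0 < s + (N + 1 + 1) * Real.pi := by linarith
  refine (abs_sincPair_le ?_).trans (le_of_eq ?_)
  · push_cast
    nlinarith
  push_cast
  rw [show s - -((N : ℝ) + 1) * Real.pi = s + (N + 1) * Real.pi by ring,
    show s - (-((N : ℝ) + 1) - 1) * Real.pi = s + (N + 1 + 1) * Real.pi by ring, abs_of_nonneg]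
  exact sub_nonneg.2 (one_div_le_one_div_of_le h1 (by linarith))

theorem summable_sincPair {s : ℝ} (hs : 0 ≤ s) : Summable (sincPair s) := by
  have hp := Real.pi_pos
  refine Summable.of_nat_of_neg ?_ ?_
  · obtain ⟨N, hN⟩ := exists_nat_gt (s / Real.pi)
    rw [div_lt_iff₀ hp] at hN
    rw [← summable_nat_add_iff (N + 1)]
    refine Summable.of_abs (summable_of_sum_range_le (c := 1 / (N * Real.pi - s))
      (fun _ => abs_nonneg _) fun m => ?_)
    have hlt : ∀ i : ℕ, s < (i + N : ℕ) * Real.pi := fun i =>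
      hN.trans_le (by gcongr; omega)
    calc ∑ i ∈ Finset.range m, |sincPair s ((i + (N + 1) : ℕ) : ℤ)|
        ≤ ∑ i ∈ Finset.range m, (1 / ((i + N : ℕ) * Real.pi - s) -
            1 / ((i + 1 + N : ℕ) * Real.pi - s)) := by
          refine Finset.sum_le_sum fun i _ => (abs_sincPair_succ_le (hlt i)).trans (le_of_eq ?_)
          rw [show i + N + 1 = i + 1 + N by ring]
      _ = 1 / ((0 + N : ℕ) * Real.pi - s) - 1 / ((m + N : ℕ) * Real.pi - s) :=
          Finset.sum_range_sub' (fun i : ℕ => 1 / ((i + N : ℕ) * Real.pi - s)) m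
      _ ≤ _ := by
          have : 0 ≤ 1 / ((m + N : ℕ) * Real.pi - s) :=
            one_div_nonneg.2 (sub_nonneg.2 (hlt m).le)
          rw [zero_add]
          linarith
  · rw [← summable_nat_add_iff 1]
    refine Summable.of_abs (summable_of_sum_range_le (c := 1 / (s + (0 + 1 : ℕ) * Real.pi))
      (fun _ => abs_nonneg _) fun m => ?_)
    calc ∑ i ∈ Finset.range m, |sincPair s (-((i + 1 : ℕ) : ℤ))|
        ≤ ∑ i ∈ Finset.range m, (1 / (s + (i + 1 : ℕ) * Real.pi) -
            1 / (s + (i + 1 + 1 : ℕ) * Real.pi)) :=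
          Finset.sum_le_sum fun i _ => abs_sincPair_neg_succ_le hs i
      _ = 1 / (s + (0 + 1 : ℕ) * Real.pi) - 1 / (s + (m + 1 : ℕ) * Real.pi) :=
          Finset.sum_range_sub' (fun i : ℕ => 1 / (s + (i + 1 : ℕ) * Real.pi)) m
      _ ≤ _ := sub_le_self _ (by positivity)

theorem hasSum_sincPair_mul_exp {s : ℝ} (hs : 0 ≤ s) {α : ℝ} (hα : |α| < 1) :
    HasSum (fun k : ℤ => (sincPair s k : ℂ) * Complex.exp (Complex.I * Real.pi * k * α))
      ((1 + Complex.exp (Complex.I * Real.pi * α)) * Complex.exp (Complex.I * s * α)) := by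
  have : Fact ((0 : ℝ) < 2) := ⟨two_pos⟩
  set G : ℝ → ℂ := fun x =>
    (1 + Complex.exp (Complex.I * Real.pi * x)) * Complex.exp (Complex.I * s * x) with hG
  -- The factor `1 + exp(iπx)` vanishes at both ends, so the 2-periodic extension is continuous;
  -- with summable coefficients its Fourier series then converges pointwise.
  have hend : G (-1) = G (-1 + 2) := by
    simp only [hG]
    have h1 : Complex.exp (Complex.I * Real.pi * (-1 : ℝ)) = -1 := by
      rw [show Complex.I * Real.pi * (-1 : ℝ) = -(Real.pi * Complex.I) by push_cast; ring,
        Complex.exp_neg, Complex.exp_pi_mul_I]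
      norm_num
    have h2 : Complex.exp (Complex.I * Real.pi * (-1 + 2 : ℝ)) = -1 := by
      rw [show Complex.I * Real.pi * (-1 + 2 : ℝ) = Real.pi * Complex.I by push_cast; ring,
        Complex.exp_pi_mul_I]
    rw [h1, h2]
    simp
  have hcont : Continuous (AddCircle.liftIco 2 (-1) G) :=
    AddCircle.liftIco_continuous hend (Continuous.continuousOn (by fun_prop))
  have hcoeff : ∀ k : ℤ, fourierCoeff (AddCircle.liftIco 2 (-1) G) k = sincPair s k := fun k => by
    rw [fourierCoeff_liftIco_eq, fourierCoeffOn_eq_integral]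
    have hterm : ∀ x : ℝ, fourier (-k) (x : AddCircle ((-1 + 2 : ℝ) - -1)) • G x =
        Complex.exp (Complex.I * ((s - k * Real.pi : ℝ) : ℂ) * x) +
        Complex.exp (Complex.I * ((s - (k - 1) * Real.pi : ℝ) : ℂ) * x) := fun x => by
      rw [fourier_coe_apply, smul_eq_mul]
      simp only [hG]
      rw [add_mul, mul_add, one_mul, ← Complex.exp_add, ← Complex.exp_add, ← Complex.exp_add]
      push_cast
      congr 2 <;> ring
    simp_rw [hterm]
    norm_num only
    rw [intervalIntegral.integral_add (Continuous.intervalIntegrable (by fun_prop) _ _)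
      (Continuous.intervalIntegrable (by fun_prop) _ _), integral_exp_I_mul_eq_sinc,
      integral_exp_I_mul_eq_sinc, sincPair]
    rw [Complex.real_smul]
    push_cast
    ring
  have hsum : Summable (fourierCoeff (⟨_, hcont⟩ : C(AddCircle (2 : ℝ), ℂ))) := by
    have : fourierCoeff (AddCircle.liftIco 2 (-1) G) = fun k => (sincPair s k : ℂ) :=
      funext hcoeff
    change Summable (fourierCoeff (AddCircle.liftIco 2 (-1) G))
    rw [this]
    exact_mod_cast summable_sincPair hs
  have h := has_pointwise_sum_fourier_series_of_summable hsum (α : AddCircle (2 : ℝ))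
  rw [abs_lt] at hα
  have hval : AddCircle.liftIco 2 (-1) G (α : AddCircle (2 : ℝ)) = G α :=
    AddCircle.liftIco_coe_apply ⟨hα.1.le, by linarith⟩
  simp only [ContinuousMap.coe_mk, hcoeff, hval, smul_eq_mul, fourier_coe_apply] at h
  convert h using 3 with k
  congr 1
  push_cast
  ring

theorem sum_Icc_neg_succ {M : Type*} [AddCommMonoid M] (a : ℤ → M) (n : ℕ) :
    ∑ k ∈ Finset.Icc (-((n + 1 : ℕ) : ℤ)) (n + 1 : ℕ), a k =
      ∑ k ∈ Finset.Icc (-(n : ℤ)) n, a k + (a (-(n + 1 : ℕ)) + a (n + 1 : ℕ)) := by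
  push_cast
  rw [Finset.Icc_succ_succ, Finset.sum_union, Finset.sum_pair]
  · omega
  · rw [Finset.disjoint_left]
    intro x hx
    simp only [Finset.mem_Icc, Finset.mem_insert, Finset.mem_singleton] at hx ⊢
    omega

theorem sum_Icc_neg_sub_one {M : Type*} [AddCommGroup M] (a : ℤ → M) (n : ℕ) :
    ∑ k ∈ Finset.Icc (-(n : ℤ)) n, a (k - 1) =
      ∑ k ∈ Finset.Icc (-(n : ℤ)) n, a k + (a (-(n + 1 : ℕ)) - a n) := by
  induction n with
  | zero => simp
  | succ n ih =>
    rw [sum_Icc_neg_succ, ih, sum_Icc_neg_succ, show ((n + 1 : ℕ) : ℤ) - 1 = n by simp,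
      show -((n + 1 : ℕ) : ℤ) - 1 = -((n + 1 + 1 : ℕ) : ℤ) by push_cast; ring]
    abel

theorem norm_exp_I_mul_pi_mul (k : ℤ) (α : ℝ) :
    ‖Complex.exp (Complex.I * Real.pi * k * α)‖ = 1 := by
  rw [show Complex.I * Real.pi * k * α = ((Real.pi * k * α : ℝ) : ℂ) * Complex.I by
    push_cast; ring, Complex.norm_exp_ofReal_mul_I]

/-- The modulus is `2 cos(πα/2)`, and the cosine lies above its chord on `[0, π/2]`. -/
theorem two_mul_one_sub_abs_le_norm_one_add_exp {α : ℝ} (hα : |α| < 1) :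
    2 * (1 - |α|) ≤ ‖1 + Complex.exp (Complex.I * Real.pi * α)‖ := by
  have hp := Real.pi_pos
  have h1 : 1 + Complex.exp (Complex.I * Real.pi * α) =
      Complex.exp (((Real.pi * α / 2 : ℝ) : ℂ) * Complex.I) *
        ((2 * Real.cos (Real.pi * α / 2) : ℝ) : ℂ) := by
    push_cast
    rw [Complex.two_cos, mul_add, ← Complex.exp_add, ← Complex.exp_add, add_comm]
    congr 1
    · congr 1; ring
    · rw [← Complex.exp_zero]; congr 1; ring
  rw [h1, norm_mul, Complex.norm_exp_ofReal_mul_I, one_mul, Complex.norm_real, Real.norm_eq_abs]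
  refine le_trans ?_ (le_abs_self _)
  have h2 := Real.one_sub_mul_le_cos (x := |Real.pi * α / 2|) (abs_nonneg _) (by
    rw [abs_div, abs_mul, abs_of_pos hp, abs_of_pos (two_pos : (0 : ℝ) < 2)]
    nlinarith)
  rw [Real.cos_abs, abs_div, abs_mul, abs_of_pos hp, abs_of_pos (two_pos : (0 : ℝ) < 2)] at h2
  have h3 : 2 / Real.pi * (Real.pi * |α| / 2) = |α| := by field_simp
  linarith

theorem norm_exp_sub_sum_sincPair_le {s : ℝ} (hs : 0 ≤ s) {α : ℝ} (hα : |α| < 1) {n : ℕ}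
    (hn : s < n * Real.pi) :
    ‖(1 + Complex.exp (Complex.I * Real.pi * α)) * Complex.exp (Complex.I * s * α) -
      ∑ k ∈ Finset.Icc (-(n : ℤ)) n,
        (sincPair s k : ℂ) * Complex.exp (Complex.I * Real.pi * k * α)‖ ≤
      1 / (n * Real.pi - s) + 1 / (s + (n + 1 : ℕ) * Real.pi) := by
  have hp := Real.pi_pos
  set c : ℤ → ℂ := fun k => (sincPair s k : ℂ) * Complex.exp (Complex.I * Real.pi * k * α)
    with hc
  set d : ℕ → ℝ := fun N => 1 / (N * Real.pi - s) + 1 / (s + (N + 1 : ℕ) * Real.pi) with hd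
  have hcn : ∀ k, ‖c k‖ = |sincPair s k| := fun k => by
    rw [hc]
    simp only
    rw [norm_mul, norm_exp_I_mul_pi_mul, mul_one, Complex.norm_real, Real.norm_eq_abs]
  have hlt : ∀ N : ℕ, n ≤ N → s < N * Real.pi := fun N hN => hn.trans_le (by gcongr)
  -- Passing from `N` to `N + 1` adds the coefficients at `±(N + 1)`, whose bounds sum exactly to `d
  -- N - d (N + 1)`.
  have hstep : ∀ N : ℕ, n ≤ N → ‖∑ k ∈ Finset.Icc (-(N : ℤ)) N, c k -
      ∑ k ∈ Finset.Icc (-(n : ℤ)) n, c k‖ ≤ d n - d N := fun N hN => by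
    induction N, hN using Nat.le_induction with
    | base => simp
    | succ N hN ih =>
      rw [sum_Icc_neg_succ, add_sub_right_comm]
      refine (norm_add_le _ _).trans ?_
      have h1 := abs_sincPair_succ_le (hlt N hN)
      have h2 := abs_sincPair_neg_succ_le hs N
      have h3 := norm_add_le (c (-(N + 1 : ℕ))) (c (N + 1 : ℕ))
      rw [hcn, hcn] at h3
      simp only [hd] at ih ⊢
      linarith
  have hlim := ((hasSum_sincPair_mul_exp hs hα).comp Finset.tendsto_Icc_neg).sub_const
    (∑ k ∈ Finset.Icc (-(n : ℤ)) n, c k)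
  refine le_of_tendsto hlim.norm ?_
  filter_upwards [eventually_ge_atTop n] with N hN
  refine (hstep N hN).trans (sub_le_self _ ?_)
  have := hlt N hN
  exact add_nonneg (one_div_nonneg.2 (by linarith)) (one_div_nonneg.2 (by positivity))

/-- Truncation error of the sampling series of `α ↦ exp (i s α)` on `(-1, 1)`. -/
theorem norm_exp_sub_sum_sinc_le {s : ℝ} (hs : 0 ≤ s) {α : ℝ} (hα : |α| < 1) {n : ℕ}
    (hn : s < n * Real.pi) :
    ‖Complex.exp (Complex.I * s * α) - ∑ k ∈ Finset.Icc (-(n : ℤ)) n,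
        (Real.sinc (s - k * Real.pi) : ℂ) * Complex.exp (Complex.I * Real.pi * k * α)‖ ≤
      (1 / (n * Real.pi - s) + 1 / (s + (n + 1 : ℕ) * Real.pi)) / (1 - |α|) := by
  have hp := Real.pi_pos
  set q := Complex.exp (Complex.I * Real.pi * α) with hq
  set a : ℤ → ℂ := fun k =>
    (Real.sinc (s - k * Real.pi) : ℂ) * Complex.exp (Complex.I * Real.pi * k * α) with ha
  set D := 1 / (n * Real.pi - s) + 1 / (s + (n + 1 : ℕ) * Real.pi) with hD
  have hpair : ∀ k : ℤ, (sincPair s k : ℂ) * Complex.exp (Complex.I * Real.pi * k * α) =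
      a k + q * a (k - 1) := fun k => by
    have : Complex.exp (Complex.I * Real.pi * k * α) =
        q * Complex.exp (Complex.I * Real.pi * (k - 1 : ℤ) * α) := by
      rw [hq, ← Complex.exp_add]
      congr 1
      push_cast
      ring
    simp only [ha]
    rw [mul_left_comm, ← this, sincPair]
    push_cast
    ring
  -- Summation by parts: shifting the index leaves only two boundary terms.
  have hU : ∑ k ∈ Finset.Icc (-(n : ℤ)) n,
        (sincPair s k : ℂ) * Complex.exp (Complex.I * Real.pi * k * α) =
      (1 + q) * ∑ k ∈ Finset.Icc (-(n : ℤ)) n, a k + q * (a (-(n + 1 : ℕ)) - a n) := by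
    simp_rw [hpair]
    rw [Finset.sum_add_distrib, ← Finset.mul_sum, sum_Icc_neg_sub_one]
    ring
  have han : ∀ k : ℤ, ‖a k‖ = |Real.sinc (s - k * Real.pi)| := fun k => by
    simp only [ha]
    rw [norm_mul, norm_exp_I_mul_pi_mul, mul_one, Complex.norm_real, Real.norm_eq_abs]
  have hq1 : ‖q‖ = 1 := by
    have := norm_exp_I_mul_pi_mul 1 α
    rwa [Int.cast_one, mul_one] at this
  -- The boundary terms obey the same bound `D` as the tail; the total `2 D` cancels the `2` in the
  -- lower bound for `‖1 + q‖`.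
  have h1 : ‖q * (a (-(n + 1 : ℕ)) - a n)‖ ≤ D := by
    rw [norm_mul, hq1, one_mul]
    have e1 : s - ((n : ℤ) : ℝ) * Real.pi = -(n * Real.pi - s) := by push_cast; ring
    have e2 : s - ((-(n + 1 : ℕ) : ℤ) : ℝ) * Real.pi = s + (n + 1 : ℕ) * Real.pi := by
      push_cast; ring
    have p1 : 0 < n * Real.pi - s := by linarith
    have p2 : 0 < s + (n + 1 : ℕ) * Real.pi := by positivity
    have b1 := abs_sinc_sub_int_mul_pi_le (s := s) (k := n) (by rw [e1]; linarith)
    have b2 := abs_sinc_sub_int_mul_pi_le (s := s) (k := -(n + 1 : ℕ)) (by rw [e2]; exact p2.ne')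
    rw [← han, e1, abs_neg, abs_of_pos p1] at b1
    rw [← han, e2, abs_of_pos p2] at b2
    refine (norm_sub_le _ _).trans ?_
    rw [hD]
    linarith
  have h2 := norm_exp_sub_sum_sincPair_le hs hα hn
  rw [hU, ← hq] at h2
  have h3 : (1 + q) * (Complex.exp (Complex.I * s * α) - ∑ k ∈ Finset.Icc (-(n : ℤ)) n, a k) =
      ((1 + q) * Complex.exp (Complex.I * s * α) -
        ((1 + q) * ∑ k ∈ Finset.Icc (-(n : ℤ)) n, a k + q * (a (-(n + 1 : ℕ)) - a n))) +
      q * (a (-(n + 1 : ℕ)) - a n) := by ring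
  have h4 := (congrArg norm h3).le.trans ((norm_add_le _ _).trans (add_le_add h2 h1))
  rw [norm_mul] at h4
  have h5 := two_mul_one_sub_abs_le_norm_one_add_exp hα
  rw [← hq] at h5
  rw [le_div_iff₀ (by linarith)]
  have h6 := mul_le_mul_of_nonneg_right h5
    (norm_nonneg (Complex.exp (Complex.I * s * α) - ∑ k ∈ Finset.Icc (-(n : ℤ)) n, a k))
  linarith

/-! ### Spectral representation and mean square error. -/

section

variable {Ω : Type*} [MeasurableSpace Ω] {P : Measure Ω}

theorem IsSSubWith.tauNorm_sum_le {ι κ : Type*} [Fintype κ] {φ : ℝ → ℝ} {Ξ : ι → Ω → ℝ} {C : ℝ}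
    (h : IsSSubWith φ P Ξ C) (i : κ → ι) (c : κ → ℝ) :
    tauNorm φ P (fun w => ∑ j, c j * Ξ (i j) w) ≤
      C * √(∫ w, (∑ j, c j * Ξ (i j) w) ^ 2 ∂P) := by
  have e := (Fintype.equivFin κ).symm
  have := h.2.2 _ (i ∘ e) (c ∘ e)
  have hsum : ∀ w, ∑ j, (c ∘ e) j * Ξ ((i ∘ e) j) w = ∑ j, c j * Ξ (i j) w := fun w =>
    e.sum_comp fun j => c j * Ξ (i j) w
  simpa only [hsum] using this

theorem IsCenteredStationary.integral_sum_sq {X : ℝ → Ω → ℝ} (h : IsCenteredStationary P X)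
    {κ : Type*} [Fintype κ] (t c : κ → ℝ) :
    ∫ w, (∑ j, c j * X (t j) w) ^ 2 ∂P = ∑ i, ∑ j, c i * c j * covFun P X (t i - t j) := by
  have hint : ∀ i j, Integrable (fun w => c i * c j * (X (t i) w * X (t j) w)) P := fun i j =>
    ((h.memLp (t i)).integrable_mul (h.memLp (t j))).const_mul _
  have hexpand : ∀ w, (∑ j, c j * X (t j) w) ^ 2 =
      ∑ i, ∑ j, c i * c j * (X (t i) w * X (t j) w) := fun w => by
    rw [sq, Finset.sum_mul_sum]
    exact Finset.sum_congr rfl fun i _ => Finset.sum_congr rfl fun j _ => by ring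
  simp_rw [hexpand]
  rw [integral_finsetSum _ fun i _ => integrable_finsetSum _ fun j _ => hint i j]
  refine Finset.sum_congr rfl fun i _ => ?_
  rw [integral_finsetSum _ fun j _ => hint i j]
  refine Finset.sum_congr rfl fun j _ => ?_
  rw [integral_const_mul, ← h.cov_eq (t j) (t i - t j), add_sub_cancel]

/-- Spectral isometry: expanding `|∑ c_j exp(i t_j l)|²` and integrating against `F` reproduces the
covariance double sum. The total mass of `F` on the band is `B(0)`. -/
theorem IsCenteredStationary.integral_sum_sq_le {X : ℝ → Ω → ℝ} (h : IsCenteredStationary P X)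
    {Λ : ℝ} (hband : IsBandlimited P X Λ) {κ : Type*} [Fintype κ] (t c : κ → ℝ) {K : ℝ}
    (hK : ∀ l ∈ Ico (-Λ) Λ, ‖∑ j, (c j : ℂ) * Complex.exp (Complex.I * t j * l)‖ ≤ K) :
    ∫ w, (∑ j, c j * X (t j) w) ^ 2 ∂P ≤ covFun P X 0 * K ^ 2 := by
  obtain ⟨F, hF, hB⟩ := hband
  set g : ℝ → ℂ := fun l => ∑ j, (c j : ℂ) * Complex.exp (Complex.I * t j * l) with hg
  have hB0 : covFun P X 0 = F.real (Ico (-Λ) Λ) := by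
    have := hB 0
    simp at this
    exact_mod_cast this
  have hexp : ∀ τ : ℝ, Integrable (fun l : ℝ => Complex.exp (Complex.I * τ * l))
      (F.restrict (Ico (-Λ) Λ)) := fun τ => by
    refine (integrable_const (1 : ℝ)).mono' (by fun_prop) (Eventually.of_forall fun l => ?_)
    rw [show Complex.I * τ * l = ((τ * l : ℝ) : ℂ) * Complex.I by push_cast; ring,
      Complex.norm_exp_ofReal_mul_I]
  have hnorm : ∀ l : ℝ, ((‖g l‖ ^ 2 : ℝ) : ℂ) =
      ∑ i, ∑ j, (c i * c j : ℂ) * Complex.exp (Complex.I * (t i - t j : ℝ) * l) := fun l => by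
    rw [Complex.ofReal_pow, ← Complex.mul_conj', hg]
    simp only
    rw [map_sum, Finset.sum_mul_sum]
    refine Finset.sum_congr rfl fun i _ => Finset.sum_congr rfl fun j _ => ?_
    rw [map_mul, ← Complex.exp_conj]
    simp only [map_mul, Complex.conj_ofReal, Complex.conj_I]
    rw [mul_mul_mul_comm, ← Complex.exp_add]
    congr 2
    push_cast
    ring
  have heq : ∫ w, (∑ j, c j * X (t j) w) ^ 2 ∂P = ∫ l in Ico (-Λ) Λ, ‖g l‖ ^ 2 ∂F := by
    rw [h.integral_sum_sq, ← Complex.ofReal_inj, ← integral_complex_ofReal]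
    simp_rw [hnorm]
    rw [integral_finsetSum _ fun i _ => integrable_finsetSum _ fun j _ => (hexp _).const_mul _]
    simp only [Complex.ofReal_sum, Complex.ofReal_mul]
    refine Finset.sum_congr rfl fun i _ => ?_
    rw [integral_finsetSum _ fun j _ => (hexp _).const_mul _]
    refine Finset.sum_congr rfl fun j _ => ?_
    rw [integral_const_mul, hB]
  rw [heq, hB0, mul_comm, ← smul_eq_mul (K ^ 2), smul_eq_mul, mul_comm, ← smul_eq_mul,
    ← setIntegral_const]
  have hcont : Continuous g := by fun_prop
  have hbd : ∀ l ∈ Ico (-Λ) Λ, ‖g l‖ ^ 2 ≤ K ^ 2 := fun l hl =>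
    pow_le_pow_left₀ (norm_nonneg _) (hK l hl) 2
  refine setIntegral_mono_on ?_ (integrable_const _) measurableSet_Ico hbd
  refine (integrable_const (K ^ 2)).mono' (by fun_prop) ?_
  filter_upwards [ae_restrict_mem measurableSet_Ico] with l hl
  rw [Real.norm_of_nonneg (by positivity)]
  exact hbd l hl

/-- Coefficients and nodes writing `X t - truncSum ω X n t` as a linear combination. -/
theorem sub_truncSum_eq {Ω : Type*} (ω : ℝ) (X : ℝ → Ω → ℝ) (n : ℕ) (t : ℝ) (w : Ω) :
    X t w - truncSum ω X n t w = ∑ j : Option (Finset.Icc (-(n : ℤ)) n),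
      (j.elim 1 fun k => -Real.sinc (ω * (t - (k : ℤ) * Real.pi / ω))) *
        X (j.elim t fun k => (k : ℤ) * Real.pi / ω) w := by
  rw [Fintype.sum_option, truncSum, sub_eq_add_neg, ← Finset.sum_neg_distrib,
    ← Finset.sum_coe_sort]
  simp

theorem truncation_const_le {ω Λ T z t s : ℝ} {n : ℕ} (hΛ : 0 < Λ) (hω : Λ < ω)
    (hz0 : 0 < z) (hz1 : z < 1) (hn0 : 0 < n) (hn : ω * T / (Real.pi * √z) ≤ n)
    (ht : 0 ≤ t) (htT : t ≤ T) (hs : s = ω * t) :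
    s < n * Real.pi ∧
    (1 / (n * Real.pi - s) + 1 / (s + (n + 1 : ℕ) * Real.pi)) / (1 - Λ / ω) ≤
      (4 * ω * t / (Real.pi ^ 2 * (1 - z)) +
        4 * (z + 1 + 1 / n) / (Real.pi * (1 - z) ^ 2 * (1 - Λ / ω))) / n := by
  have hp := Real.pi_pos
  have hω0 : 0 < ω := hΛ.trans hω
  have hnR : (0 : ℝ) < n := by exact_mod_cast hn0
  have hr : 0 < √z := Real.sqrt_pos.2 hz0
  have hr2 : √z ^ 2 = z := Real.sq_sqrt hz0.le
  have hr1 : √z < 1 := by nlinarith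
  have hg : 0 < 1 - Λ / ω := by rw [sub_pos, div_lt_one hω0]; exact hω
  have hs0 : 0 ≤ s := by rw [hs]; positivity
  rw [div_le_iff₀ (by positivity)] at hn
  set m := n * Real.pi with hm
  have hm0 : 0 < m := by positivity
  -- This is where the lower bound on `n` enters: it gives `m² - s² ≥ m²(1 - z)`.
  have hsm : s ≤ m * √z := by
    have : ω * t ≤ ω * T := by gcongr
    nlinarith
  have hlt : s < m := by nlinarith
  refine ⟨hlt, ?_⟩
  have hsq : s ^ 2 ≤ m ^ 2 * z := by
    rw [← hr2, ← mul_pow]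
    gcongr
  have h1 : 1 / (m - s) + 1 / (s + (n + 1 : ℕ) * Real.pi) ≤ 2 / (m * (1 - z)) := by
    have e1 : 1 / (s + (n + 1 : ℕ) * Real.pi) ≤ 1 / (s + m) := by
      apply one_div_le_one_div_of_le (by positivity)
      push_cast
      nlinarith
    have e2 : 1 / (m - s) + 1 / (s + m) = 2 * m / (m ^ 2 - s ^ 2) := by
      have : m - s ≠ 0 := by linarith
      have : s + m ≠ 0 := by positivity
      have : m ^ 2 - s ^ 2 ≠ 0 := by nlinarith
      field_simp
      ring
    have e3 : 2 * m / (m ^ 2 - s ^ 2) ≤ 2 * m / (m ^ 2 * (1 - z)) := by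
      apply div_le_div_of_nonneg_left (by positivity) _ (by linarith)
      have : 0 < 1 - z := by linarith
      positivity
    have e4 : 2 * m / (m ^ 2 * (1 - z)) = 2 / (m * (1 - z)) := by
      have : 1 - z ≠ 0 := by linarith
      field_simp
    linarith
  have hz' : 0 < 1 - z := by linarith
  calc (1 / (m - s) + 1 / (s + (n + 1 : ℕ) * Real.pi)) / (1 - Λ / ω)
      ≤ 2 / (m * (1 - z)) / (1 - Λ / ω) := by gcongr
    -- The second summand of `C_n` alone suffices, since `2(1 - z) ≤ 4(z + 1 + 1/n)`.
    _ = (2 * (1 - z) / (Real.pi * (1 - z) ^ 2 * (1 - Λ / ω))) / n := by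
        rw [hm]; field_simp
    _ ≤ _ := by
        gcongr
        refine le_add_of_nonneg_of_le (by positivity) ?_
        gcongr
        · norm_num
        · have : (0 : ℝ) < 1 / n := by positivity
          linarith

/-- Mean square truncation error of the sampling sum. -/
theorem integral_sub_truncSum_sq_le {X : ℝ → Ω → ℝ} (h : IsCenteredStationary P X)
    {ω Λ T z t : ℝ} {n : ℕ} (hband : IsBandlimited P X Λ) (hΛ : 0 < Λ) (hω : Λ < ω)
    (hz0 : 0 < z) (hz1 : z < 1) (hn0 : 0 < n) (hn : ω * T / (Real.pi * √z) ≤ n)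
    (ht : 0 ≤ t) (htT : t ≤ T) :
    ∫ w, (X t w - truncSum ω X n t w) ^ 2 ∂P ≤ errC (covFun P X 0) ω Λ z n t / (n : ℝ) ^ 2 := by
  have hω0 : 0 < ω := hΛ.trans hω
  obtain ⟨hlt, hle⟩ := truncation_const_le hΛ hω hz0 hz1 hn0 hn ht htT rfl
  simp_rw [sub_truncSum_eq]
  rw [errC, mul_div_assoc, ← div_pow]
  refine h.integral_sum_sq_le hband _ _ fun l hl => ?_
  have hl' : |l| ≤ Λ := abs_le.2 ⟨hl.1, hl.2.le⟩
  have habs : |l / ω| ≤ Λ / ω := by rw [abs_div, abs_of_pos hω0]; gcongr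
  have hΛω : Λ / ω < 1 := (div_lt_one hω0).2 hω
  have hωC : (ω : ℂ) ≠ 0 := by exact_mod_cast hω0.ne'
  have hmain := norm_exp_sub_sum_sinc_le (s := ω * t) (by positivity) (habs.trans_lt hΛω) hlt
  refine le_trans (le_of_eq ?_) (hmain.trans (le_trans ?_ hle))
  · congr 1
    rw [Fintype.sum_option, sub_eq_add_neg (Complex.exp _), ← Finset.sum_neg_distrib,
      ← Finset.sum_coe_sort (Finset.Icc (-(n : ℤ)) n)]
    simp only [Option.elim_none, Option.elim_some]
    congr 1
    · push_cast
      rw [one_mul]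
      congr 1
      field_simp
    · refine Finset.sum_congr rfl fun k _ => ?_
      rw [show ω * (t - (k : ℤ) * Real.pi / ω) = ω * t - (k : ℤ) * Real.pi by field_simp]
      push_cast
      rw [neg_mul]
      congr 3
      field_simp
  · have : 0 < 1 - Λ / ω := by linarith
    have : 0 < n * Real.pi - ω * t := by linarith
    gcongr

end

/-! ### Tail bounds for `L_p` norms. -/

section

variable {Ω : Type*} [MeasurableSpace Ω] {P : Measure Ω}

/-- Weighted AM-GM combined with `x ≤ exp (x - 1)`. -/
theorem rpow_le_exp_mix {x p s : ℝ} (hx : 0 ≤ x) (hp : 0 < p) (hps : p ≤ s) :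
    x ^ p ≤ p / s * Real.exp (s * (x - 1)) + (1 - p / s) := by
  have hs : 0 < s := hp.trans_le hps
  have hle : p / s ≤ 1 := (div_le_one hs).2 hps
  have h1 : x ≤ Real.exp (x - 1) := by linarith [Real.add_one_le_exp (x - 1)]
  have h2 := convexOn_exp.2 (mem_univ (s * (x - 1))) (mem_univ 0) (div_nonneg hp.le hs.le)
    (sub_nonneg.2 hle) (add_sub_cancel _ _)
  simp only [smul_eq_mul, mul_zero, add_zero, Real.exp_zero, mul_one] at h2
  refine le_trans ?_ h2
  calc x ^ p ≤ Real.exp (x - 1) ^ p := Real.rpow_le_rpow hx h1 hp.le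
    _ = Real.exp (p / s * (s * (x - 1))) := by
      rw [← Real.exp_mul]
      congr 1
      field_simp

/-- Since `exp(l|ξ|) ≤ exp(lξ) + exp(-lξ)`; the resulting factor `2` is why the theorem asks for
`δ/2`. -/
theorem lintegral_exp_mul_abs_le {ξ : Ω → ℝ} {l B : ℝ} (hl : 0 ≤ l)
    (hB : ∀ l' : ℝ, |l'| = l → Integrable (fun w => Real.exp (l' * ξ w)) P ∧
      ∫ w, Real.exp (l' * ξ w) ∂P ≤ B) :
    ∫⁻ w, ENNReal.ofReal (Real.exp (l * |ξ w|)) ∂P ≤ ENNReal.ofReal (2 * B) := by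
  obtain ⟨h1, h1'⟩ := hB l (abs_of_nonneg hl)
  obtain ⟨h2, h2'⟩ := hB (-l) (by rw [abs_neg, abs_of_nonneg hl])
  calc ∫⁻ w, ENNReal.ofReal (Real.exp (l * |ξ w|)) ∂P
      ≤ ∫⁻ w, ENNReal.ofReal (Real.exp (l * ξ w) + Real.exp (-l * ξ w)) ∂P := by
        refine lintegral_mono fun w => ENNReal.ofReal_le_ofReal ?_
        rcases abs_choice (ξ w) with h | h <;> rw [h]
        · linarith [Real.exp_pos (-l * ξ w)]
        · rw [mul_neg, ← neg_mul]
          linarith [Real.exp_pos (l * ξ w)]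
    _ = ENNReal.ofReal (∫ w, (Real.exp (l * ξ w) + Real.exp (-l * ξ w)) ∂P) :=
        (ofReal_integral_eq_lintegral_ofReal (h1.add h2)
          (Eventually.of_forall fun w =>
            (add_pos (Real.exp_pos _) (Real.exp_pos _)).le)).symm
    _ ≤ ENNReal.ofReal (2 * B) := by
        rw [integral_add h1 h2]
        exact ENNReal.ofReal_le_ofReal (by linarith)

/-- Tail bound for the `L_p` norm of a measurable process whose sections have exponential moments
dominated by `exp (φ (τ t * l))`. -/
theorem measure_integral_rpow_gt_le [IsProbabilityMeasure P] {A : Type*} [MeasurableSpace A]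
    {μ : Measure A} [SFinite μ]
    {φ : ℝ → ℝ} (hφ : ∀ x, φ (-x) = φ x) {Y : A → Ω → ℝ}
    (hY : Measurable fun q : A × Ω => Y q.1 q.2) {τ : A → ℝ} (hτm : Measurable τ)
    (hτ : ∀ᵐ t ∂μ, 0 < τ t)
    (hexp : ∀ᵐ t ∂μ, ∀ l : ℝ, Integrable (fun w => Real.exp (l * Y t w)) P ∧
      ∫ w, Real.exp (l * Y t w) ∂P ≤ Real.exp (φ (τ t * l)))
    {p : ℝ} (hp : 0 < p) (hint : Integrable (fun t => τ t ^ p) μ)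
    (hS : 0 < ∫ t, τ t ^ p ∂μ) {a y : ℝ} (ha : 0 < a) (hy : p ≤ a * y) :
    (∀ᵐ w ∂P, Integrable (fun t => |Y t w| ^ p) μ) ∧
      P.real {w | (∫ t, τ t ^ p ∂μ) * a ^ p < ∫ t, |Y t w| ^ p ∂μ} ≤
        2 * Real.exp (φ y - a * y) := by
  set S := ∫ t, τ t ^ p ∂μ with hSdef
  have hs : 0 < a * y := hp.trans_le hy
  have hy0 : 0 < y := pos_of_mul_pos_right hs ha.le
  have hps : 0 < p / (a * y) := by positivity
  have hps1 : p / (a * y) ≤ 1 := (div_le_one hs).2 hy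
  -- The weights `τ^p / S` have total mass one, and the exponent is `s(x - 1)` with `x = |Y|/(aτ)`,
  -- `s = a y`.
  set E : A → Ω → ℝ := fun t w => τ t ^ p / S * Real.exp (-(a * y)) *
    Real.exp (y / τ t * |Y t w|) with hE
  have hEm : Measurable (fun q : A × Ω => E q.1 q.2) := by
    have hτ' : Measurable fun q : A × Ω => τ q.1 := hτm.comp measurable_fst
    simp only [hE]
    exact (((hτ'.pow_const p).div_const S).mul_const _).mul
      (((measurable_const.div hτ').mul hY.abs).exp)
  set Z : Ω → ENNReal := fun w => ∫⁻ t, ENNReal.ofReal (E t w) ∂μ with hZ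
  have hZm : Measurable Z := hEm.ennreal_ofReal.lintegral_prod_left'
  have hEZ : ∫⁻ w, Z w ∂P ≤ ENNReal.ofReal (2 * Real.exp (φ y - a * y)) := by
    simp only [hZ]
    rw [lintegral_lintegral_swap (hEm.comp measurable_swap).ennreal_ofReal.aemeasurable]
    calc ∫⁻ t, ∫⁻ w, ENNReal.ofReal (E t w) ∂P ∂μ
        ≤ ∫⁻ t, ENNReal.ofReal (τ t ^ p / S * (2 * Real.exp (φ y - a * y))) ∂μ := by
          refine lintegral_mono_ae ?_
          filter_upwards [hτ, hexp] with t ht hext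
          have hc : 0 ≤ τ t ^ p / S * Real.exp (-(a * y)) := by positivity
          have h1 := lintegral_exp_mul_abs_le (P := P) (ξ := Y t) (l := y / τ t)
            (B := Real.exp (φ y)) (by positivity) fun l' hl' => by
              refine ⟨(hext l').1, (hext l').2.trans_eq ?_⟩
              congr 1
              rw [abs_eq (by positivity)] at hl'
              rcases hl' with rfl | rfl
              · rw [mul_div_cancel₀ _ ht.ne']
              · rw [mul_neg, hφ, mul_div_cancel₀ _ ht.ne']
          simp only [hE]
          simp_rw [ENNReal.ofReal_mul hc]
          rw [lintegral_const_mul' _ _ ENNReal.ofReal_ne_top]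
          refine (mul_le_mul_right h1 _).trans_eq ?_
          rw [← ENNReal.ofReal_mul hc]
          congr 1
          rw [sub_eq_neg_add, Real.exp_add]
          ring
      _ = ENNReal.ofReal (∫ t, τ t ^ p / S * (2 * Real.exp (φ y - a * y)) ∂μ) := by
          refine (ofReal_integral_eq_lintegral_ofReal ((hint.div_const S).mul_const _) ?_).symm
          filter_upwards [hτ] with t ht
          simp only [Pi.zero_apply]
          positivity
      _ = _ := by
          rw [integral_mul_const, integral_div, ← hSdef, div_self hS.ne', one_mul]
  have hpt : ∀ᵐ t ∂μ, ∀ w, |Y t w| ^ p ≤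
      S * a ^ p * (p / (a * y)) * E t w + a ^ p * (1 - p / (a * y)) * τ t ^ p := by
    filter_upwards [hτ] with t ht w
    have h1 := rpow_le_exp_mix (x := |Y t w| / (a * τ t)) (by positivity) hp hy
    rw [Real.div_rpow (abs_nonneg _) (by positivity), div_le_iff₀ (by positivity),
      Real.mul_rpow ha.le ht.le, show a * y * (|Y t w| / (a * τ t) - 1) =
        -(a * y) + y / τ t * |Y t w| by field_simp; ring, Real.exp_add] at h1
    refine h1.trans_eq ?_
    simp only [hE]
    field_simp
  -- Finiteness of `Z` gives existence of the integral, and `Z < 1` makes the convex combination in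
  -- `hpt` integrate to at most `S a^p`. The bad event thus forces `Z ≥ 1`, to which Markov's
  -- inequality applies.
  have hmain : ∀ w, Z w < ⊤ → Integrable (fun t => |Y t w| ^ p) μ ∧
      (Z w < 1 → ∫ t, |Y t w| ^ p ∂μ ≤ S * a ^ p) := by
    intro w hw
    have hE0 : 0 ≤ᵐ[μ] fun t => E t w := by
      filter_upwards [hτ] with t ht
      simp only [hE, Pi.zero_apply]
      positivity
    have hEw : Measurable fun t => E t w := hEm.of_uncurry_right
    have hEi : Integrable (fun t => E t w) μ :=
      ⟨hEw.aestronglyMeasurable, (hasFiniteIntegral_iff_ofReal hE0).2 hw⟩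
    have hdom : Integrable (fun t => S * a ^ p * (p / (a * y)) * E t w +
        a ^ p * (1 - p / (a * y)) * τ t ^ p) μ := (hEi.const_mul _).add (hint.const_mul _)
    have hYi : Integrable (fun t => |Y t w| ^ p) μ := by
      refine hdom.mono' ?_ ?_
      · exact (hY.of_uncurry_right.abs.pow_const p).aestronglyMeasurable
      · filter_upwards [hpt] with t ht
        rw [Real.norm_of_nonneg (by positivity)]
        exact ht w
    refine ⟨hYi, fun hw1 => ?_⟩
    have h1 : ∫ t, E t w ∂μ ≤ 1 := by
      rw [integral_eq_lintegral_of_nonneg_ae hE0 hEw.aestronglyMeasurable]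
      exact ENNReal.toReal_le_of_le_ofReal zero_le_one (by simpa using hw1.le)
    calc ∫ t, |Y t w| ^ p ∂μ
        ≤ ∫ t, (S * a ^ p * (p / (a * y)) * E t w + a ^ p * (1 - p / (a * y)) * τ t ^ p) ∂μ :=
          integral_mono_ae hYi hdom (hpt.mono fun t ht => ht w)
      _ = S * a ^ p * (p / (a * y)) * (∫ t, E t w ∂μ) + a ^ p * (1 - p / (a * y)) * S := by
          rw [integral_add (hEi.const_mul _) (hint.const_mul _), integral_const_mul,
            integral_const_mul]
      _ ≤ S * a ^ p * (p / (a * y)) * 1 + a ^ p * (1 - p / (a * y)) * S := by gcongr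
      _ = S * a ^ p := by ring
  refine ⟨?_, ?_⟩
  · filter_upwards [ae_lt_top hZm (hEZ.trans_lt ENNReal.ofReal_lt_top).ne] with w hw
    exact (hmain w hw).1
  · have hsub : {w | S * a ^ p < ∫ t, |Y t w| ^ p ∂μ} ⊆ {w | 1 ≤ Z w} := by
      intro w hw
      by_contra hlt
      rw [mem_ofPred_eq, not_le] at hlt
      exact absurd ((hmain w (hlt.trans ENNReal.one_lt_top)).2 hlt) (not_le.2 hw)
    refine ENNReal.toReal_le_of_le_ofReal (by positivity) ((measure_mono hsub).trans ?_)
    have := mul_meas_ge_le_lintegral (μ := P) hZm 1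
    rw [one_mul] at this
    exact this.trans hEZ

/-- The bound `exp (φ y - a y)` at all `y ≥ p / a` gives the Young-Fenchel transform at `a`,
because the density at `p / a` is at most `a`. -/
theorem le_two_mul_exp_neg_youngFenchel {φ : ℝ → ℝ} (hφ : IsOrliczNFunction φ) {a p r : ℝ}
    (ha : 0 < a) (hf : orliczDensity φ (p / a) ≤ a)
    (hr : ∀ y, p ≤ a * y → r ≤ 2 * Real.exp (φ y - a * y)) :
    r ≤ 2 * Real.exp (-youngFenchel φ a) := by
  have hall : ∀ y, r ≤ 2 * Real.exp (-(a * y - φ y)) := fun y => by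
    rcases le_or_gt (p / a) y with h | h
    · have := hr y (by rwa [div_le_iff₀' ha] at h)
      rwa [neg_sub]
    -- To the left of `p/a` the supporting line there has slope at most `a`, so `φ y - a y` is no
    -- smaller than its value at `p/a`.
    · refine (hr (p / a) (mul_div_cancel₀ _ ha.ne').ge).trans ?_
      gcongr
      have := hφ.add_orliczDensity_mul_le h
      nlinarith
  rcases le_or_gt r 0 with h0 | h0
  · exact h0.trans (by positivity)
  have hlog : ∀ y, a * y - φ y ≤ -Real.log (r / 2) := fun y => by
    have := hall y
    rw [le_neg, Real.log_le_iff_le_exp (by positivity)]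
    linarith
  have : youngFenchel φ a ≤ -Real.log (r / 2) := ciSup_le hlog
  rw [le_neg, Real.log_le_iff_le_exp (by positivity)] at this
  linarith

theorem integrableOn_errC_rpow {B0 ω Λ z p : ℝ} (hp : 0 < p) (n : ℕ) (T : ℝ) :
    IntegrableOn (fun t => errC B0 ω Λ z n t ^ (p / 2)) (Ioc 0 T) := by
  refine (Continuous.integrableOn_Icc ?_).mono_set Ioc_subset_Icc_self
  refine Continuous.rpow_const ?_ fun _ => Or.inr (by positivity)
  unfold errC
  fun_prop

theorem youngFenchel_zero_nonpos {φ : ℝ → ℝ} (hφ : IsOrliczNFunction φ) : youngFenchel φ 0 ≤ 0 :=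
  ciSup_le fun y => by
    have := hφ.nonneg y
    linarith

end

/-! ### Assembly of the estimates. -/

theorem theorem4 {Ω : Type*} [MeasurableSpace Ω] (P : Measure Ω) [IsProbabilityMeasure P]
    (φ : ℝ → ℝ) (hφ : IsOrliczNFunction φ) (hQ : ConditionQ φ)
    (X : ℝ → Ω → ℝ) (hX : Measurable (fun q : ℝ × Ω => X q.1 q.2))
    (hstat : IsCenteredStationary P X)
    (CX : ℝ) (hsub : IsSSubWith φ P X CX)
    (Λ ω : ℝ) (hΛ : 0 < Λ) (hω : Λ < ω) (hband : IsBandlimited P X Λ)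
    (T : ℝ) (hT : 0 < T) (p : ℝ) (hp : 1 ≤ p)
    (z : ℝ) (hz0 : 0 < z) (hz1 : z < 1)
    (n : ℕ) (hn : ω * T / (Real.pi * √z) ≤ n)
    (ε δ : ℝ) (hε : 0 < ε) (hδ0 : 0 < δ) (hδ1 : δ < 1)
    (h1 : errS CX (covFun P X 0) ω Λ z T p n *
        orliczDensity φ (p * (errS CX (covFun P X 0) ω Λ z T p n / ε) ^ (1 / p)) ^ p < ε)
    (h2 : Real.exp (-youngFenchel φ ((ε / errS CX (covFun P X 0) ω Λ z T p n) ^ (1 / p)))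
        ≤ δ / 2) :
    ApproximatesLp P X (truncSum ω X n) p T ε δ := by
  have hpi := Real.pi_pos
  have hω0 : 0 < ω := hΛ.trans hω
  have hp0 : 0 < p := one_pos.trans_le hp
  have hCX : 0 < CX := hsub.2.1
  have hn0 : 0 < n := by
    have : (0 : ℝ) < n := lt_of_lt_of_le (by have := Real.sqrt_pos.2 hz0; positivity) hn
    exact_mod_cast this
  have hnR : (0 : ℝ) < n := by exact_mod_cast hn0
  set B0 := covFun P X 0 with hB0def
  have hB0 : 0 ≤ B0 := integral_nonneg fun w => mul_self_nonneg _
  set S := errS CX B0 ω Λ z T p n with hS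
  have hgap : 0 < 1 - Λ / ω := by rw [sub_pos, div_lt_one hω0]; exact hω
  have hz' : 0 < 1 - z := by linarith
  have hC0 : ∀ t, 0 ≤ errC B0 ω Λ z n t := fun t => by unfold errC; positivity
  have hS0 : 0 ≤ S := mul_nonneg (by positivity)
    (intervalIntegral.integral_nonneg hT.le fun t _ => Real.rpow_nonneg (hC0 t) _)
  -- If `S = 0`, then `ε / S` is `0` by convention, and `φ*(0) ≤ 0` would force `1 ≤ δ/2`.
  have hSpos : 0 < S := by
    refine hS0.lt_of_ne fun h => ?_
    rw [← h, div_zero, Real.zero_rpow (by positivity)] at h2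
    have := Real.one_le_exp (neg_nonneg.2 (youngFenchel_zero_nonpos hφ))
    linarith
  have hB0pos : 0 < B0 := by
    refine hB0.lt_of_ne fun h => hSpos.ne' ?_
    rw [hS, ← h, errS]
    simp [errC, Real.zero_rpow (show p / 2 ≠ 0 by positivity)]
  have hC : ∀ t, 0 ≤ t → 0 < errC B0 ω Λ z n t := fun t ht => by
    unfold errC
    positivity
  set τ : ℝ → ℝ := fun t => CX / n * √(errC B0 ω Λ z n t) with hτ
  have hτp : ∀ t, τ t ^ p = (CX / n) ^ p * errC B0 ω Λ z n t ^ (p / 2) := fun t => by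
    simp only [hτ]
    rw [Real.mul_rpow (by positivity) (Real.sqrt_nonneg _), Real.sqrt_eq_rpow,
      ← Real.rpow_mul (hC0 t)]
    congr 2
    ring
  have hτS : ∫ t in Ioc 0 T, τ t ^ p = S := by
    simp_rw [hτp]
    rw [integral_const_mul, hS, errS, intervalIntegral.integral_of_le hT.le]
  have hτi : IntegrableOn (fun t => τ t ^ p) (Ioc 0 T) := by
    simp_rw [hτp]
    exact (integrableOn_errC_rpow hp0 n T).const_mul _
  have hτm : Measurable τ := by
    simp only [hτ]
    unfold errC
    fun_prop
  have hYm : Measurable fun q : ℝ × Ω => X q.1 q.2 - truncSum ω X n q.1 q.2 := by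
    refine hX.sub (Finset.measurable_sum _ fun k _ => ?_)
    exact (Real.measurable_sinc.comp (by fun_prop)).mul
      (hX.comp (measurable_const.prodMk measurable_snd))
  have hexp : ∀ t ∈ Ioc 0 T, ∀ l : ℝ,
      Integrable (fun w => Real.exp (l * (X t w - truncSum ω X n t w))) P ∧
      ∫ w, Real.exp (l * (X t w - truncSum ω X n t w)) ∂P ≤ Real.exp (φ (τ t * l)) := by
    intro t ht l
    have hmem : MemSub φ P fun w => X t w - truncSum ω X n t w := by
      simp_rw [sub_truncSum_eq]
      exact MemSub.sum hφ (fun _ => hsub.1 _) _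
    have htau : tauNorm φ P (fun w => X t w - truncSum ω X n t w) ≤ τ t := by
      have h3 := hsub.tauNorm_sum_le (κ := Option (Finset.Icc (-(n : ℤ)) n))
        (fun j => j.elim t fun k => (k : ℤ) * Real.pi / ω)
        (fun j => j.elim 1 fun k => -Real.sinc (ω * (t - (k : ℤ) * Real.pi / ω)))
      simp_rw [← sub_truncSum_eq] at h3
      have h4 := Real.sqrt_le_sqrt
        (integral_sub_truncSum_sq_le hstat hband hΛ hω hz0 hz1 hn0 hn ht.1.le ht.2)
      rw [Real.sqrt_div' _ (by positivity), Real.sqrt_sq hnR.le] at h4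
      refine (h3.trans (mul_le_mul_of_nonneg_left h4 hCX.le)).trans_eq ?_
      simp only [hτ]
      ring
    exact ⟨(hmem.2.2.choose_spec.2 l).1, hmem.integral_exp_le hφ htau l⟩
  set a := (ε / S) ^ (1 / p) with ha
  have ha0 : 0 < a := by positivity
  have hap : S * a ^ p = ε := by
    rw [ha, ← Real.rpow_mul (by positivity), one_div_mul_cancel hp0.ne', Real.rpow_one]
    field_simp
  -- As `(S/ε)^(1/p) = 1/a` and `ε = S a^p`, the first condition reads `S f(p/a)^p < S a^p`.
  have hfa : orliczDensity φ (p / a) ≤ a := by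
    have e : p * (S / ε) ^ (1 / p) = p / a := by
      rw [ha, div_eq_mul_inv p, ← Real.inv_rpow (by positivity), inv_div]
    rw [e, ← hap] at h1
    exact (lt_of_mul_lt_mul_left h1 hS0 |> fun h => (Real.rpow_lt_rpow_iff
      (by
        rw [← (isOrliczDensity_orliczDensity hφ).map_zero]
        exact monotone_orliczDensity hφ (by positivity)) ha0.le hp0).1 h).le
  have key := fun y hy => measure_integral_rpow_gt_le (P := P) (μ := volume.restrict (Ioc 0 T))
    hφ.even hYm hτm
    ((ae_restrict_mem measurableSet_Ioc).mono fun t ht => by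
      have := Real.sqrt_pos.2 (hC t ht.1.le)
      simp only [hτ]
      positivity)
    ((ae_restrict_mem measurableSet_Ioc).mono hexp) hp0 hτi (hτS.symm ▸ hSpos) (y := y) ha0 hy
  refine ⟨?_, ?_⟩
  · filter_upwards [(key (p / a) (mul_div_cancel₀ _ ha0.ne').ge).1] with w hw
    exact (intervalIntegrable_iff_integrableOn_Ioc_of_le hT.le).2 hw
  · simp_rw [intervalIntegral.integral_of_le hT.le]
    have h3 := le_two_mul_exp_neg_youngFenchel hφ ha0 hfa fun y hy => (key y hy).2
    rw [hτS, hap] at h3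
    linarith
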